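/- A function $\eta\colon \mathbb{R}^m\to\mathbb{R}^k$ is a *$\mathbb{Z}$-map* if it is continuous and there are finitely many affine maps $\eta_1,\dots,\eta_r\colon\mathbb{R}^m\to\mathbb{R}^k$ with integer coefficients such that for every $x\in\mathbb{R}^m$ there is $i\le r$ with $\eta(x)=\eta_i(x)$. For $A\subseteq\mathbb{R}^m$ and $B\subseteq\mathbb{R}^k$, a function $A\to B$ is a *$\mathbb{Z}$-map* if it is the restriction of a $\mathbb{Z}$-map $\mathbb{R}^m\to\mathbb{R}^k$. Let $\mathfrak{B}\subseteq\mathbb{R}^2$ be the boundary of the unit square $[0,1]^2$. A $\mathbb{Z}$-map $\sigma\colon[0,1]^{n_2}\to\mathfrak{B}$ is *more general* than a $\mathbb{Z}$-map $\tau\colon[0,1]^{n_1}\to\mathfrak{B}$ if there is a $\mathbb{Z}$-map $\alpha\colon[0,1]^{n_1}\to[0,1]^{n_2}$ with $\sigma\circ\alpha=\tau$; it is *strictly more general* if, in addition, $\tau$ is not more general than $\sigma$. **Lemma.** Let $n\ge 2$, and let $\eta\colon[0,1]^n\to\mathfrak{B}$ be a $\mathbb{Z}$-map that is not constant on the boundary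 of $[0,1]^n$. Then there is a $\mathbb{Z}$-map $\theta\colon[0,1]^n\to\mathfrak{B}$ that is strictly more general than $\eta$. -/

import Mathlib

/-- A map `ℝᵐ → ℝⁿ` that is affine with integer coefficients. -/
def IsIntAffine {m n : ℕ} (f : (Fin m → ℝ) → (Fin n → ℝ)) : Prop :=
  ∃ (A : Matrix (Fin n) (Fin m) ℤ) (b : Fin n → ℤ),
    ∀ (x : Fin m → ℝ) (j : Fin n), f x j = (b j : ℝ) + ∑ i : Fin m, (A j i : ℝ) * x i

/-- A ℤ-map `ℝᵐ → ℝⁿ`: a continuous map that at each point agrees with one of finitely many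
affine maps with integer coefficients. -/
def IsZMap {m n : ℕ} (η : (Fin m → ℝ) → (Fin n → ℝ)) : Prop :=
  Continuous η ∧
    ∃ (k : ℕ) (f : Fin k → (Fin m → ℝ) → (Fin n → ℝ)),
      (∀ i, IsIntAffine (f i)) ∧ ∀ x, ∃ i, η x = f i x

/-- A ℤ-map `A → B` between subsets `A ⊆ ℝᵐ` and `B ⊆ ℝⁿ`: a restriction of a ℤ-map `ℝᵐ → ℝⁿ`. -/
def IsZMapBetween {m n : ℕ} {A : Set (Fin m → ℝ)} {B : Set (Fin n → ℝ)} (η : A → B) : Prop :=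
  ∃ η' : (Fin m → ℝ) → (Fin n → ℝ), IsZMap η' ∧ ∀ x : A, η' x = η x

/-- The cube `[0,1]ⁿ` in `ℝⁿ`. -/
def unitCube (n : ℕ) : Set (Fin n → ℝ) := {x | ∀ i, 0 ≤ x i ∧ x i ≤ 1}

/-- The boundary `𝔅` of the unit square `[0,1]²`, as the union of the four sides. -/
def squareBoundary : Set (Fin 2 → ℝ) :=
  convexHull ℝ {![0, 0], ![1, 0]} ∪ convexHull ℝ {![1, 0], ![1, 1]} ∪
    convexHull ℝ {![1, 1], ![0, 1]} ∪ convexHull ℝ {![0, 1], ![0, 0]}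

/-- `σ : [0,1]^{n₂} → B` is more general than `τ : [0,1]^{n₁} → B`: the map `τ` factors as `σ ∘ α`
for some ℤ-map `α : [0,1]^{n₁} → [0,1]^{n₂}`. -/
def MoreGeneral {n₁ n₂ d : ℕ} {B : Set (Fin d → ℝ)}
    (σ : unitCube n₂ → B) (τ : unitCube n₁ → B) : Prop :=
  ∃ α : unitCube n₁ → unitCube n₂, IsZMapBetween α ∧ σ ∘ α = τ

/-- `σ` is strictly more general than `τ`. -/
def StrictlyMoreGeneral {n₁ n₂ d : ℕ} {B : Set (Fin d → ℝ)}
    (σ : unitCube n₂ → B) (τ : unitCube n₁ → B) : Prop :=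
  MoreGeneral σ τ ∧ ¬ MoreGeneral τ σ

/-!
The map `η` lifts through the universal cover `squareCover : ℝ → 𝔅` to a real-valued ℤ-map `E` on
the cube (`exists_zmap_lift`); the lift is again a ℤ-map because on each side of `𝔅` the arc length
is an integer affine function of the coordinates, and only finitely many sheets are reached.

Since `η` is not constant on the boundary and `n ≥ 2`, the lift `E` is not constant on some facet
(`eq_on_frontier_of_eq_on_facets`). Hence there is a point in the relative interior of that facet
near which `E` is a single integer affine function, not constant along the facet
(`exists_affine_point_of_facet`). Some integer vector `v` pointing into the cube then lies in the
direction of the level sets of `E`, and with a small enough bump `h` the ℤ-map `α x = x + h x • v`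
maps the cube into itself, satisfies `E ∘ α = E`, and misses a point `q` of the facet
(`exists_not_surjOn_comp_eq`).

Now `E` can be changed at will off the image of `α`: adding a large multiple of a bump at `q` gives
`F` with `F ∘ α = E`, and `θ = squareCover ∘ F` satisfies `θ ∘ α = η`. Conversely, if `η ∘ β = θ`
then `E ∘ β` and `F` are two lifts of the same map, so they differ by a constant; this is impossible
because the values of `F` spread further apart than those of `E`.
-/

/-! ### Piecewise integer affine functions -/

/-- The affine function with integer coefficients `c.1` and constant term `c.2`. -/
def intAffine {m : ℕ} (c : (Fin m → ℤ) × ℤ) (x : Fin m → ℝ) : ℝ :=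
  c.2 + ∑ i, (c.1 i : ℝ) * x i

/-- `f` agrees at each point with one of finitely many affine functions with integer coefficients.
Continuity is not included. -/
def IsIntPiecewise {m : ℕ} (f : (Fin m → ℝ) → ℝ) : Prop :=
  ∃ S : Set ((Fin m → ℤ) × ℤ), S.Finite ∧ ∀ x, ∃ c ∈ S, f x = intAffine c x

lemma continuous_intAffine {m : ℕ} (c : (Fin m → ℤ) × ℤ) : Continuous (intAffine c) := by
  unfold intAffine
  fun_prop

lemma intAffine_add {m : ℕ} (c : (Fin m → ℤ) × ℤ) (x v : Fin m → ℝ) :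
    intAffine c (x + v) = intAffine c x + ∑ i, (c.1 i : ℝ) * v i := by
  simp [intAffine, mul_add, Finset.sum_add_distrib, add_assoc]

lemma intAffine_update {m : ℕ} (c : (Fin m → ℤ) × ℤ) (x : Fin m → ℝ) (i : Fin m) (t : ℝ) :
    intAffine c (Function.update x i t) = intAffine c x + c.1 i * (t - x i) := by
  have h : Function.update x i t = x + Pi.single i (t - x i) := by
    ext j
    by_cases hj : j = i
    · subst hj; simp
    · simp [hj]
  rw [h, intAffine_add]
  simp [Pi.single_apply]

namespace IsIntPiecewise

variable {m : ℕ}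

/-- A function which at each point agrees with one of finitely many piecewise integer affine
functions is itself piecewise integer affine. -/
lemma of_forall_exists {ι : Type*} {s : Set ι} (hs : s.Finite) {F : ι → (Fin m → ℝ) → ℝ}
    (hF : ∀ i ∈ s, IsIntPiecewise (F i)) {f : (Fin m → ℝ) → ℝ}
    (h : ∀ x, ∃ i ∈ s, f x = F i x) : IsIntPiecewise f := by
  choose! S hS hx using hF
  refine ⟨⋃ i ∈ s, S i, hs.biUnion hS, fun x ↦ ?_⟩
  obtain ⟨i, hi, hfi⟩ := h x
  obtain ⟨c, hc, hcx⟩ := hx i hi x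
  exact ⟨c, Set.mem_biUnion hi hc, hfi.trans hcx⟩

lemma affine (c : (Fin m → ℤ) × ℤ) : IsIntPiecewise (intAffine c) :=
  ⟨{c}, Set.finite_singleton c, fun _ ↦ ⟨c, rfl, rfl⟩⟩

lemma intConst (k : ℤ) : IsIntPiecewise (fun _ : Fin m → ℝ ↦ (k : ℝ)) := by
  convert affine ((0, k) : (Fin m → ℤ) × ℤ) using 1
  ext x
  simp [intAffine]

lemma coord (i : Fin m) : IsIntPiecewise (fun x : Fin m → ℝ ↦ x i) := by
  convert affine ((Pi.single i 1, 0) : (Fin m → ℤ) × ℤ) using 1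
  ext x
  simp [intAffine, Pi.single_apply]

lemma add {f g : (Fin m → ℝ) → ℝ} (hf : IsIntPiecewise f) (hg : IsIntPiecewise g) :
    IsIntPiecewise (fun x ↦ f x + g x) := by
  obtain ⟨S, hS, hfS⟩ := hf
  obtain ⟨T, hT, hgT⟩ := hg
  refine ⟨_, hS.image2 (· + ·) hT, fun x ↦ ?_⟩
  obtain ⟨c, hc, hcx⟩ := hfS x
  obtain ⟨d, hd, hdx⟩ := hgT x
  refine ⟨c + d, Set.mem_image2_of_mem hc hd, ?_⟩
  simp only [hcx, hdx, intAffine, Prod.fst_add, Prod.snd_add, Pi.add_apply, Int.cast_add, add_mul,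
    Finset.sum_add_distrib]
  ring

lemma intMul (k : ℤ) {f : (Fin m → ℝ) → ℝ} (hf : IsIntPiecewise f) :
    IsIntPiecewise (fun x ↦ k * f x) := by
  obtain ⟨S, hS, hfS⟩ := hf
  refine ⟨_, hS.image (k • ·), fun x ↦ ?_⟩
  obtain ⟨c, hc, hcx⟩ := hfS x
  refine ⟨k • c, Set.mem_image_of_mem _ hc, ?_⟩
  simp [hcx, intAffine, mul_add, Finset.mul_sum, mul_assoc]

lemma neg {f : (Fin m → ℝ) → ℝ} (hf : IsIntPiecewise f) : IsIntPiecewise (fun x ↦ -f x) := by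
  simpa using hf.intMul (-1)

lemma sub {f g : (Fin m → ℝ) → ℝ} (hf : IsIntPiecewise f) (hg : IsIntPiecewise g) :
    IsIntPiecewise (fun x ↦ f x - g x) := by
  simpa [sub_eq_add_neg] using hf.add hg.neg

lemma sum {ι : Type*} (s : Finset ι) {F : ι → (Fin m → ℝ) → ℝ}
    (hF : ∀ i ∈ s, IsIntPiecewise (F i)) : IsIntPiecewise (fun x ↦ ∑ i ∈ s, F i x) := by
  classical
  induction s using Finset.induction_on with
  | empty => simpa using intConst (m := m) 0
  | insert a s ha ih =>
    simp only [Finset.sum_insert ha]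
    exact (hF a (by simp)).add (ih fun i hi ↦ hF i (by simp [hi]))

lemma of_or {f g h : (Fin m → ℝ) → ℝ} (hf : IsIntPiecewise f) (hg : IsIntPiecewise g)
    (hfg : ∀ x, h x = f x ∨ h x = g x) : IsIntPiecewise h := by
  refine of_forall_exists (Set.toFinite (Set.univ : Set Bool)) (F := fun b ↦ cond b f g) ?_ ?_
  · rintro (_ | _) -
    exacts [hg, hf]
  · intro x
    rcases hfg x with h | h
    exacts [⟨true, trivial, h⟩, ⟨false, trivial, h⟩]

lemma max {f g : (Fin m → ℝ) → ℝ} (hf : IsIntPiecewise f) (hg : IsIntPiecewise g) :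
    IsIntPiecewise (fun x ↦ Max.max (f x) (g x)) :=
  of_or hf hg fun x ↦ max_choice (f x) (g x)

lemma min {f g : (Fin m → ℝ) → ℝ} (hf : IsIntPiecewise f) (hg : IsIntPiecewise g) :
    IsIntPiecewise (fun x ↦ Min.min (f x) (g x)) :=
  of_or hf hg fun x ↦ min_choice (f x) (g x)

lemma abs {f : (Fin m → ℝ) → ℝ} (hf : IsIntPiecewise f) : IsIntPiecewise (fun x ↦ |f x|) :=
  of_or hf hf.neg fun x ↦ abs_choice (f x)

lemma comp {k : ℕ} {f : (Fin k → ℝ) → ℝ} (hf : IsIntPiecewise f)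
    {u : (Fin m → ℝ) → (Fin k → ℝ)} (hu : ∀ j, IsIntPiecewise (fun x ↦ u x j)) :
    IsIntPiecewise (fun x ↦ f (u x)) := by
  obtain ⟨S, hS, hfS⟩ := hf
  refine of_forall_exists hS (F := fun c x ↦ intAffine c (u x)) (fun c _ ↦ ?_) fun x ↦ hfS (u x)
  exact (intConst c.2).add (sum _ fun i _ ↦ (hu i).intMul _)

end IsIntPiecewise

lemma isZMap_iff {m n : ℕ} (η : (Fin m → ℝ) → (Fin n → ℝ)) :
    IsZMap η ↔ Continuous η ∧ ∀ j, IsIntPiecewise (fun x ↦ η x j) := by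
  refine and_congr_right fun _ ↦ ⟨?_, fun h ↦ ?_⟩
  · rintro ⟨k, f, hf, hx⟩ j
    choose A b hAb using hf
    refine ⟨_, Set.finite_range fun i ↦ ((fun l ↦ A i j l, b i j) : (Fin m → ℤ) × ℤ), fun x ↦ ?_⟩
    obtain ⟨i, hi⟩ := hx x
    exact ⟨_, ⟨i, rfl⟩, by simp only [hi, hAb]; rfl⟩
  · choose S hS hx using h
    have hfin := Set.Finite.pi' hS
    have := hfin.to_subtype
    obtain ⟨k, ⟨e⟩⟩ := Finite.exists_equiv_fin {c : Fin n → (Fin m → ℤ) × ℤ | ∀ j, c j ∈ S j}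
    refine ⟨k, fun i x j ↦ intAffine ((e.symm i).1 j) x, fun i ↦
      ⟨fun j ↦ ((e.symm i).1 j).1, fun j ↦ ((e.symm i).1 j).2, fun x j ↦ rfl⟩, fun x ↦ ?_⟩
    choose c hc hcx using fun j ↦ hx j x
    refine ⟨e ⟨c, hc⟩, ?_⟩
    ext j
    simpa using hcx j

/-! ### The unit cube -/

/-- The nearest-point retraction of `ℝⁿ` onto the unit cube. -/
def cubeClamp {n : ℕ} (x : Fin n → ℝ) : Fin n → ℝ := fun i ↦ max 0 (min 1 (x i))

lemma continuous_cubeClamp {n : ℕ} : Continuous (cubeClamp (n := n)) := by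
  unfold cubeClamp
  fun_prop

lemma cubeClamp_mem {n : ℕ} (x : Fin n → ℝ) : cubeClamp x ∈ unitCube n :=
  fun _ ↦ ⟨le_max_left _ _, max_le zero_le_one (min_le_left _ _)⟩

lemma cubeClamp_of_mem {n : ℕ} {x : Fin n → ℝ} (hx : x ∈ unitCube n) : cubeClamp x = x := by
  ext i
  simp [cubeClamp, min_eq_right (hx i).2, max_eq_right (hx i).1]

lemma isIntPiecewise_cubeClamp {n : ℕ} (i : Fin n) :
    IsIntPiecewise (fun x : Fin n → ℝ ↦ cubeClamp x i) := by
  simpa [cubeClamp] using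
    (IsIntPiecewise.intConst 0).max ((IsIntPiecewise.intConst 1).min (IsIntPiecewise.coord i))

lemma unitCube_eq_Icc (n : ℕ) : unitCube n = Set.Icc 0 1 := by
  ext x
  simp [unitCube, Set.mem_Icc, Pi.le_def, forall_and]

lemma isCompact_unitCube (n : ℕ) : IsCompact (unitCube n) := by
  rw [unitCube_eq_Icc]
  exact isCompact_Icc

lemma convex_unitCube (n : ℕ) : Convex ℝ (unitCube n) := by
  rw [unitCube_eq_Icc]
  exact convex_Icc 0 1

lemma interior_unitCube (n : ℕ) : interior (unitCube n) = {x | ∀ i, 0 < x i ∧ x i < 1} := by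
  rw [unitCube_eq_Icc, ← Set.pi_univ_Icc, interior_pi_set Set.finite_univ]
  ext x
  simp [Set.mem_pi]

lemma exists_coord_of_mem_frontier {n : ℕ} {x : Fin n → ℝ} (hx : x ∈ frontier (unitCube n)) :
    x ∈ unitCube n ∧ ∃ i, x i = 0 ∨ x i = 1 := by
  have hmem := (isCompact_unitCube n).isClosed.frontier_subset hx
  refine ⟨hmem, ?_⟩
  by_contra! h
  refine hx.2 ?_
  rw [interior_unitCube]
  exact fun i ↦ ⟨(hmem i).1.lt_of_ne' (h i).1, (hmem i).2.lt_of_ne (h i).2⟩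

/-! ### The universal cover of the boundary of the square -/

lemma mem_squareBoundary_iff (y : Fin 2 → ℝ) :
    y ∈ squareBoundary ↔
      ((0 ≤ y 0 ∧ y 0 ≤ 1) ∧ (y 1 = 0 ∨ y 1 = 1)) ∨
        ((0 ≤ y 1 ∧ y 1 ≤ 1) ∧ (y 0 = 0 ∨ y 0 = 1)) := by
  simp only [squareBoundary, convexHull_pair, Set.mem_union, segment_eq_image, Set.mem_image,
    Set.mem_Icc]
  constructor
  · rintro (((⟨t, ht, rfl⟩ | ⟨t, ht, rfl⟩) | ⟨t, ht, rfl⟩) | ⟨t, ht, rfl⟩) <;>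
      simp [ht.1, ht.2]
  · rintro (⟨h, h' | h'⟩ | ⟨h, h' | h'⟩)
    · refine .inl (.inl (.inl ⟨y 0, h, ?_⟩))
      ext i; fin_cases i <;> simp [h']
    · refine .inl (.inr ⟨1 - y 0, by constructor <;> linarith, ?_⟩)
      ext i; fin_cases i <;> simp [h']
    · refine .inr ⟨1 - y 1, by constructor <;> linarith, ?_⟩
      ext i; fin_cases i <;> simp [h']
    · refine .inl (.inl (.inr ⟨y 1, h, ?_⟩))
      ext i; fin_cases i <;> simp [h']

/-- The counterclockwise arc-length parametrization of `𝔅` on `[0,4]`, starting at the origin. -/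
def squareLoop (r : ℝ) : Fin 2 → ℝ :=
  ![max 0 (min 1 (min r (3 - r))), max 0 (min 1 (min (r - 1) (4 - r)))]

lemma continuous_squareLoop : Continuous squareLoop := by
  refine continuous_pi fun i ↦ ?_
  fin_cases i <;> simp only [squareLoop] <;> dsimp <;> fun_prop

/-- On `[0,4]` the loop runs through the four sides in turn. -/
lemma squareLoop_cases {r : ℝ} (h0 : 0 ≤ r) (h4 : r ≤ 4) :
    (r ≤ 1 ∧ squareLoop r = ![r, 0]) ∨ (1 ≤ r ∧ r ≤ 2 ∧ squareLoop r = ![1, r - 1]) ∨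
      (2 ≤ r ∧ r ≤ 3 ∧ squareLoop r = ![3 - r, 1]) ∨ (3 ≤ r ∧ squareLoop r = ![0, 4 - r]) := by
  have key : ∀ a b : ℝ, max 0 (min 1 (min r (3 - r))) = a →
      max 0 (min 1 (min (r - 1) (4 - r))) = b → squareLoop r = ![a, b] := by
    rintro a b rfl rfl; rfl
  rcases le_total r 1 with h1 | h1
  · refine .inl ⟨h1, key _ _ ?_ ?_⟩ <;> grind
  rcases le_total r 2 with h2 | h2
  · refine .inr (.inl ⟨h1, h2, key _ _ ?_ ?_⟩) <;> grind
  rcases le_total r 3 with h3 | h3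
  · refine .inr (.inr (.inl ⟨h2, h3, key _ _ ?_ ?_⟩)) <;> grind
  · refine .inr (.inr (.inr ⟨h3, key _ _ ?_ ?_⟩)) <;> grind

lemma squareLoop_mem {r : ℝ} (h0 : 0 ≤ r) (h4 : r ≤ 4) : squareLoop r ∈ squareBoundary := by
  rw [mem_squareBoundary_iff]
  rcases squareLoop_cases h0 h4 with ⟨h, e⟩ | ⟨h, h', e⟩ | ⟨h, h', e⟩ | ⟨h, e⟩ <;> rw [e] <;>
    simp <;> grind

/-- The arc-length parameter is recovered from the coordinates by one of four affine functions. -/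
lemma eq_of_squareLoop {r : ℝ} (h0 : 0 ≤ r) (h4 : r ≤ 4) :
    r = squareLoop r 0 ∨ r = 1 + squareLoop r 1 ∨ r = 3 - squareLoop r 0 ∨
      r = 4 - squareLoop r 1 := by
  rcases squareLoop_cases h0 h4 with ⟨h, e⟩ | ⟨h, h', e⟩ | ⟨h, h', e⟩ | ⟨h, e⟩ <;> rw [e] <;> simp

lemma squareLoop_injOn : Set.InjOn squareLoop (Set.Ico 0 4) := by
  intro r hr s hs h
  have hx := congrFun h 0
  have hy := congrFun h 1
  rcases squareLoop_cases hr.1 hr.2.le with ⟨_, e⟩ | ⟨_, _, e⟩ | ⟨_, _, e⟩ | ⟨_, e⟩ <;>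
  rcases squareLoop_cases hs.1 hs.2.le with ⟨_, e'⟩ | ⟨_, _, e'⟩ | ⟨_, _, e'⟩ | ⟨_, e'⟩ <;>
    simp only [e, e', Matrix.cons_val_zero, Matrix.cons_val_one] at hx hy <;>
    linarith [hr.1, hr.2, hs.1, hs.2]

lemma exists_squareLoop_eq {y : Fin 2 → ℝ} (hy : y ∈ squareBoundary) :
    ∃ r ∈ Set.Ico (0 : ℝ) 4, squareLoop r = y := by
  have hl : ∀ r, (max 0 (min 1 (min r (3 - r))) = y 0 ∧
      max 0 (min 1 (min (r - 1) (4 - r))) = y 1) → squareLoop r = y := by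
    rintro r ⟨h, h'⟩
    ext i
    fin_cases i
    exacts [h, h']
  rw [mem_squareBoundary_iff] at hy
  rcases hy with ⟨h, h' | h'⟩ | ⟨h, h' | h'⟩
  · exact ⟨y 0, ⟨h.1, by linarith⟩, hl _ (by grind)⟩
  · exact ⟨3 - y 0, ⟨by linarith, by linarith⟩, hl _ (by grind)⟩
  · -- The parameter `4 - y 1` is the excluded endpoint `4` when `y` is the origin.
    rcases h.1.eq_or_lt with h0 | h0
    · exact ⟨0, by simp, hl _ (by grind)⟩
    · exact ⟨4 - y 1, ⟨by linarith, by linarith⟩, hl _ (by grind)⟩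
  · exact ⟨1 + y 1, ⟨by linarith, by linarith⟩, hl _ (by grind)⟩

instance fact_zero_lt_four : Fact ((0 : ℝ) < 4) := ⟨by norm_num⟩

/-- The homeomorphism from the circle of length `4` onto `𝔅`, as a map into the plane. -/
noncomputable def circleToSquare : AddCircle (4 : ℝ) → (Fin 2 → ℝ) :=
  AddCircle.liftIco 4 0 squareLoop

lemma continuous_circleToSquare : Continuous circleToSquare := by
  refine AddCircle.liftIco_zero_continuous ?_ continuous_squareLoop.continuousOn
  ext i
  fin_cases i <;> norm_num [squareLoop]

lemma exists_mem_Ico_eq_coe (a : AddCircle (4 : ℝ)) :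
    ∃ r ∈ Set.Ico (0 : ℝ) 4, (r : AddCircle (4 : ℝ)) = a ∧ circleToSquare a = squareLoop r := by
  have h : (AddCircle.equivIco (4 : ℝ) 0 a : ℝ) ∈ Set.Ico (0 : ℝ) 4 := by
    simpa using (AddCircle.equivIco (4 : ℝ) 0 a).2
  refine ⟨_, h, AddCircle.coe_equivIco, ?_⟩
  rfl

lemma circleToSquare_mem (a : AddCircle (4 : ℝ)) : circleToSquare a ∈ squareBoundary := by
  obtain ⟨r, hr, -, h⟩ := exists_mem_Ico_eq_coe a
  exact h ▸ squareLoop_mem hr.1 hr.2.le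

lemma circleToSquare_injective : Function.Injective circleToSquare := by
  intro a b hab
  obtain ⟨r, hr, rfl, h⟩ := exists_mem_Ico_eq_coe a
  obtain ⟨s, hs, rfl, h'⟩ := exists_mem_Ico_eq_coe b
  rw [squareLoop_injOn hr hs (h ▸ h' ▸ hab)]

lemma exists_circleToSquare_eq {y : Fin 2 → ℝ} (hy : y ∈ squareBoundary) :
    ∃ a, circleToSquare a = y := by
  obtain ⟨r, hr, h⟩ := exists_squareLoop_eq hy
  exact ⟨r, (AddCircle.liftIco_zero_coe_apply hr).trans h⟩

/-- The universal covering `ℝ → 𝔅` by arc length. -/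
noncomputable def squareCover (t : ℝ) : Fin 2 → ℝ := circleToSquare (t : AddCircle (4 : ℝ))

lemma continuous_squareCover : Continuous squareCover :=
  continuous_circleToSquare.comp (AddCircle.continuous_mk' 4)

lemma squareCover_mem (t : ℝ) : squareCover t ∈ squareBoundary := circleToSquare_mem _

lemma exists_eq_add_of_squareCover_eq {s t : ℝ} (h : squareCover s = squareCover t) :
    ∃ k : ℤ, s - t = 4 * k := by
  obtain ⟨k, hk⟩ := AddSubgroup.mem_zmultiples_iff.1
    (QuotientAddGroup.eq_iff_sub_mem.1 (circleToSquare_injective h))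
  exact ⟨k, by rw [← hk, zsmul_eq_mul, mul_comm]⟩

/-- `squareCover` is given on each interval `[4k, 4k+4)` by the translate of `squareLoop`. -/
lemma exists_squareCover_eq_squareLoop (t : ℝ) :
    ∃ k : ℤ, 0 ≤ t - 4 * k ∧ t - 4 * k < 4 ∧ squareCover t = squareLoop (t - 4 * k) := by
  obtain ⟨r, hr, hrt, h⟩ := exists_mem_Ico_eq_coe (t : AddCircle (4 : ℝ))
  have : squareCover t = squareCover r := by rw [squareCover, squareCover, hrt]
  obtain ⟨k, hk⟩ := exists_eq_add_of_squareCover_eq this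
  refine ⟨k, ?_⟩
  have e : t - 4 * k = r := by linarith
  rw [e]
  exact ⟨hr.1, hr.2, h⟩

/-- Any continuous map `ℝⁿ → 𝔅` lifts through the universal covering. -/
lemma exists_lift_squareCover {n : ℕ} {f : (Fin n → ℝ) → (Fin 2 → ℝ)} (hf : Continuous f)
    (hmem : ∀ x, f x ∈ squareBoundary) :
    ∃ E : (Fin n → ℝ) → ℝ, Continuous E ∧ ∀ x, squareCover (E x) = f x := by
  -- Being a continuous bijection between compact Hausdorff spaces, `circleToSquare` is a
  -- homeomorphism onto `𝔅`.
  let P : AddCircle (4 : ℝ) → squareBoundary := fun a ↦ ⟨circleToSquare a, circleToSquare_mem a⟩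
  have hPc : Continuous P := continuous_circleToSquare.subtype_mk _
  have hP : Function.Bijective P := by
    refine ⟨fun a b h ↦ circleToSquare_injective (congrArg Subtype.val h), fun y ↦ ?_⟩
    obtain ⟨a, ha⟩ := exists_circleToSquare_eq y.2
    exact ⟨a, Subtype.ext ha⟩
  let H : AddCircle (4 : ℝ) ≃ₜ squareBoundary :=
    Continuous.homeoOfEquivCompactToT2 (f := Equiv.ofBijective P hP) hPc
  let φ : C(Fin n → ℝ, AddCircle (4 : ℝ)) :=
    ⟨fun x ↦ H.symm ⟨f x, hmem x⟩, H.symm.continuous.comp (hf.subtype_mk _)⟩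
  obtain ⟨e, he⟩ := QuotientAddGroup.mk_surjective (φ 0)
  obtain ⟨E, ⟨-, hE⟩, -⟩ :=
    (AddCircle.isCoveringMap_coe (4 : ℝ)).existsUnique_continuousMap_lifts φ 0 e he
  refine ⟨E, E.continuous, fun x ↦ ?_⟩
  have h1 : ((E x : ℝ) : AddCircle (4 : ℝ)) = H.symm ⟨f x, hmem x⟩ := congrFun hE x
  have h2 : P (H.symm ⟨f x, hmem x⟩) = ⟨f x, hmem x⟩ := H.apply_symm_apply _
  rw [squareCover, h1]
  exact congrArg Subtype.val h2

/-- If `|t| ≤ B` then the integer `k` in `exists_squareCover_eq_squareLoop` lies in a fixed finite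
set. -/
lemma mem_Icc_of_abs_le {B : ℕ} {t : ℝ} (ht : |t| ≤ B) {k : ℤ} (h0 : 0 ≤ t - 4 * k)
    (h4 : t - 4 * k < 4) : k ∈ Set.Icc (-(B : ℤ) - 1) B := by
  rw [abs_le] at ht
  have hB : (0 : ℝ) ≤ B := B.cast_nonneg
  have h1 : -(B : ℝ) - 1 ≤ k := by linarith
  have h2 : (k : ℝ) ≤ B := by linarith
  exact ⟨by exact_mod_cast h1, by exact_mod_cast h2⟩

/-- A bounded lift of a piecewise integer affine map into `𝔅` is piecewise integer affine. -/
lemma IsIntPiecewise.of_squareCover {n B : ℕ} {E : (Fin n → ℝ) → ℝ} (hB : ∀ x, |E x| ≤ B)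
    (hE : ∀ j, IsIntPiecewise (fun x ↦ squareCover (E x) j)) : IsIntPiecewise E := by
  refine of_forall_exists ((Set.finite_Icc (-(B : ℤ) - 1) B).prod (Set.finite_univ (α := Fin 4)))
    (F := fun p x ↦ (4 * p.1 : ℤ) + ![squareCover (E x) 0, 1 + squareCover (E x) 1,
      3 - squareCover (E x) 0, 4 - squareCover (E x) 1] p.2)
    (fun p _ ↦ (intConst _).add ?_) fun x ↦ ?_
  · obtain ⟨k, j⟩ := p
    fin_cases j
    · exact hE 0
    · simpa using (intConst 1).add (hE 1)
    · simpa using (intConst 3).sub (hE 0)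
    · simpa using (intConst 4).sub (hE 1)
  · obtain ⟨k, h0, h4, h⟩ := exists_squareCover_eq_squareLoop (E x)
    have hk := mem_Icc_of_abs_le (hB x) h0 h4
    have hr := eq_of_squareLoop h0 h4.le
    rw [← h] at hr
    rcases hr with hr | hr | hr | hr
    · exact ⟨(k, 0), ⟨hk, trivial⟩, by simp; linarith⟩
    · exact ⟨(k, 1), ⟨hk, trivial⟩, by simp; linarith⟩
    · exact ⟨(k, 2), ⟨hk, trivial⟩, by simp; linarith⟩
    · exact ⟨(k, 3), ⟨hk, trivial⟩, by simp; linarith⟩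

lemma IsIntPiecewise.squareCover_comp {n B : ℕ} {E : (Fin n → ℝ) → ℝ} (hB : ∀ x, |E x| ≤ B)
    (hE : IsIntPiecewise E) (j : Fin 2) : IsIntPiecewise (fun x ↦ squareCover (E x) j) := by
  refine of_forall_exists (Set.finite_Icc (-(B : ℤ) - 1) B)
    (F := fun k x ↦ squareLoop (E x - (4 * k : ℤ)) j) (fun k _ ↦ ?_) fun x ↦ ?_
  · have hr := hE.sub (intConst (4 * k))
    have hx := (intConst 0).max ((intConst 1).min (hr.min ((intConst 3).sub hr)))
    have hy := (intConst 0).max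
      ((intConst 1).min ((hr.sub (intConst 1)).min ((intConst 4).sub hr)))
    fin_cases j
    · simpa [squareLoop] using hx
    · simpa [squareLoop] using hy
  · obtain ⟨k, h0, h4, h⟩ := exists_squareCover_eq_squareLoop (E x)
    exact ⟨k, mem_Icc_of_abs_le (hB x) h0 h4, by rw [h]; push_cast; rfl⟩

/-! ### Bumps with integer coefficients -/

/-- Around every point there is a nonnegative bump with integer coefficients and arbitrarily small
support. -/
lemma exists_bump {n : ℕ} (q : Fin n → ℝ) {ε : ℝ} (hε : 0 < ε) :
    ∃ g : (Fin n → ℝ) → ℝ, Continuous g ∧ IsIntPiecewise g ∧ (∀ x, 0 ≤ g x) ∧ 1 ≤ g q ∧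
      ∀ x, g x ≠ 0 → dist x q < ε := by
  obtain ⟨N, hN⟩ := exists_nat_gt ((n + 2) / ε)
  have hN0 : (0 : ℝ) < N := lt_of_le_of_lt (by positivity) hN
  rw [div_lt_iff₀ hε] at hN
  refine ⟨fun x ↦ max 0 (n + 1 - ∑ j, |N * x j - ⌊N * q j⌋|), by fun_prop, ?_,
    fun x ↦ le_max_left _ _, ?_, fun x hx ↦ ?_⟩
  · have h := (IsIntPiecewise.intConst 0).max <| (IsIntPiecewise.intConst (n + 1)).sub <|
      IsIntPiecewise.sum Finset.univ fun (j : Fin n) _ ↦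
        (((IsIntPiecewise.coord j).intMul N).sub (IsIntPiecewise.intConst ⌊N * q j⌋)).abs
    simpa using h
  · have : ∑ j, |N * q j - ⌊N * q j⌋| ≤ ∑ j : Fin n, 1 := Finset.sum_le_sum fun j _ ↦ by
      rw [abs_of_nonneg (Int.fract_nonneg _)]
      exact (Int.fract_lt_one _).le
    simp only [Finset.sum_const, Finset.card_univ, Fintype.card_fin, nsmul_eq_mul, mul_one] at this
    exact le_max_of_le_right (by linarith)
  · have hs : ∑ j, |N * x j - ⌊N * q j⌋| < n + 1 := by
      by_contra! h
      exact hx (max_eq_left (by linarith))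
    rw [dist_pi_lt_iff hε]
    intro j
    have h1 : |N * x j - ⌊N * q j⌋| < n + 1 := lt_of_le_of_lt
      (Finset.single_le_sum (f := fun j ↦ |N * x j - ⌊N * q j⌋|) (fun _ _ ↦ abs_nonneg _)
        (Finset.mem_univ j)) hs
    have h2 := Int.floor_le (N * q j)
    have h3 := Int.lt_floor_add_one (N * q j)
    rw [abs_lt] at h1
    rw [Real.dist_eq, abs_lt]
    constructor <;> nlinarith

/-- A bump with integer coefficients and arbitrarily small height and support. Its values at a
rational point of denominator `d` are multiples of `1 / d`, so that the point `q'` where it is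
required to be positive can only be prescribed approximately; it is obtained from `q` by changing
the coordinate `l`. -/
lemma exists_small_bump {n : ℕ} (q : Fin n → ℝ) (l : Fin n) {ε δ : ℝ} (hε : 0 < ε) (hδ : 0 < δ) :
    ∃ (q' : Fin n → ℝ) (h : (Fin n → ℝ) → ℝ), (∀ j, j ≠ l → q' j = q j) ∧ dist q' q < ε ∧
      Continuous h ∧ IsIntPiecewise h ∧ (∀ x, 0 ≤ h x) ∧ (∀ x, h x ≤ δ) ∧ 0 < h q' ∧
      ∀ x, h x ≠ 0 → dist x q < ε := by
  obtain ⟨ρ, hρ1, hρ2⟩ := exists_rat_btwn (show q l < q l + ε / 2 by linarith)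
  have hN : (0 : ℝ) < ρ.den := by exact_mod_cast ρ.den_pos
  have hρ : (ρ.den : ℝ) * ρ = ρ.num := by exact_mod_cast Rat.den_mul_eq_num ρ
  -- The function `|den ρ * x l - num ρ|` vanishes at `x l = ρ` and so is small and positive at
  -- `x l = ρ + τ`.
  set τ : ℝ := min (ε / 4) (δ / (2 * ρ.den)) with hτ
  have hτ0 : 0 < τ := by positivity
  have hτ1 : τ ≤ ε / 4 := min_le_left _ _
  have hτ2 : ρ.den * τ ≤ δ / 2 := by
    calc ρ.den * τ ≤ ρ.den * (δ / (2 * ρ.den)) := by gcongr; exact min_le_right _ _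
      _ = δ / 2 := by field_simp
  set q' := Function.update q l (ρ + τ) with hq'
  have hq'l : q' l = ρ + τ := by simp [hq']
  have hq'q : dist q' q < 3 * ε / 4 := by
    rw [dist_pi_lt_iff (by positivity)]
    intro j
    by_cases hj : j = l
    · subst hj
      rw [hq'l, Real.dist_eq, abs_lt]
      constructor <;> linarith
    · simp only [hq', Function.update_of_ne hj, dist_self]
      positivity
  obtain ⟨g, hgc, hgp, hg0, hg1, hgs⟩ := exists_bump q' hτ0
  have hs : ∀ x, min (g x) |ρ.den * x l - ρ.num| ≠ 0 → dist x q' < τ := fun x hx ↦ hgs x fun h0 ↦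
    hx (by rw [h0]; exact min_eq_left (abs_nonneg _))
  refine ⟨q', fun x ↦ min (g x) |ρ.den * x l - ρ.num|, fun j hj ↦ Function.update_of_ne hj _ _,
    by linarith, by fun_prop, ?_, fun x ↦ le_min (hg0 x) (abs_nonneg _), fun x ↦ ?_, ?_,
    fun x hx ↦ ?_⟩
  · simpa using hgp.min
      (((IsIntPiecewise.coord l).intMul ρ.den).sub (IsIntPiecewise.intConst ρ.num)).abs
  · by_cases hx : min (g x) |ρ.den * x l - ρ.num| = 0
    · exact hx.trans_le hδ.le
    · have h1 := (dist_le_pi_dist x q' l).trans_lt (hs x hx)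
      rw [hq'l, Real.dist_eq, abs_lt] at h1
      refine (min_le_right _ _).trans ?_
      rw [← hρ, abs_le]
      constructor <;> nlinarith
  · refine lt_min (by linarith) ?_
    rw [hq'l, mul_add, hρ, add_sub_cancel_left]
    positivity
  · linarith [hs x hx, dist_triangle x q' q]

/-! ### Local affineness at generic points of a facet -/

lemma eq_of_forall_exists_int {α : Type*} [TopologicalSpace α] {s : Set α} (hs : IsPreconnected s)
    {f : α → ℝ} (hf : ContinuousOn f s) (hint : ∀ x ∈ s, ∃ k : ℤ, f x = k) {x y : α}
    (hx : x ∈ s) (hy : y ∈ s) : f x = f y := by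
  have hT : IsDiscrete (Set.range ((↑) : ℤ → ℝ)) :=
    Int.isClosedEmbedding_coe_real.toIsEmbedding.isDiscrete_range
  refine hs.constant_of_mapsTo hT hf (fun z hz ↦ ?_) hx hy
  obtain ⟨k, hk⟩ := hint z hz
  exact ⟨k, hk.symm⟩

lemma intAffine_sub {m : ℕ} (c d : (Fin m → ℤ) × ℤ) (x : Fin m → ℝ) :
    intAffine (c - d) x = intAffine c x - intAffine d x := by
  simp only [intAffine, Prod.fst_sub, Prod.snd_sub, Pi.sub_apply, Int.cast_sub, sub_mul,
    Finset.sum_sub_distrib]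
  ring

lemma intAffine_lineMap {m : ℕ} (c : (Fin m → ℤ) × ℤ) (x y : Fin m → ℝ) (t : ℝ) :
    intAffine c (x + t • (y - x)) = intAffine c x + t * (intAffine c y - intAffine c x) := by
  rw [intAffine_add]
  simp only [intAffine, Pi.smul_apply, Pi.sub_apply, smul_eq_mul, mul_sub, Finset.mul_sum, mul_add,
    Finset.sum_sub_distrib]
  congr 1
  simp only [mul_left_comm t]
  ring

/-- An affine function that does not vanish identically on the hyperplane `x i = a` vanishes on a
nowhere dense subset of it. The hyperplane is parametrized by `y ↦ Function.update y i a`. -/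
lemma dense_intAffine_update_ne_zero {m : ℕ} (c : (Fin m → ℤ) × ℤ) (i : Fin m) (a : ℝ)
    (h : ∃ y, intAffine c (Function.update y i a) ≠ 0) :
    Dense {y | intAffine c (Function.update y i a) ≠ 0} := by
  obtain ⟨y', hy'⟩ := h
  intro y
  by_cases hy : intAffine c (Function.update y i a) = 0
  · have hlim : Filter.Tendsto (fun t : ℝ ↦ y + t • (y' - y)) (nhdsWithin 0 {0}ᶜ) (nhds y) := by
      have : ContinuousAt (fun t : ℝ ↦ y + t • (y' - y)) 0 := by fun_prop
      simpa [ContinuousAt] using this.mono_left (nhdsWithin_le_nhds (s := {0}ᶜ))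
    refine mem_closure_of_tendsto hlim (eventually_mem_nhdsWithin.mono fun t ht ↦ ?_)
    have hu : Function.update (y + t • (y' - y)) i a =
        Function.update y i a + t • (Function.update y' i a - Function.update y i a) := by
      ext j
      by_cases hj : j = i
      · subst hj; simp
      · simp [hj]
    rw [Set.mem_ofPred_eq, hu, intAffine_lineMap, hy, zero_add, sub_zero]
    exact mul_ne_zero ht hy'
  · exact subset_closure hy

lemma nonempty_interior_unitCube (n : ℕ) : (interior (unitCube n)).Nonempty :=
  ⟨fun _ ↦ 1 / 2, by rw [interior_unitCube]; intro i; norm_num⟩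

lemma unitCube_subset_closure_interior (n : ℕ) : unitCube n ⊆ closure (interior (unitCube n)) := by
  rw [(convex_unitCube n).closure_interior_eq_closure_of_nonempty_interior
    (nonempty_interior_unitCube n)]
  exact subset_closure

lemma update_mem_unitCube {n : ℕ} {x : Fin n → ℝ} (hx : x ∈ unitCube n) (i : Fin n) {a : ℝ}
    (ha : a = 0 ∨ a = 1) : Function.update x i a ∈ unitCube n := by
  intro j
  by_cases hj : j = i
  · subst hj
    rcases ha with rfl | rfl <;> simp
  · simpa [hj] using hx j

/-- Let `E` be continuous and given by the affine functions in the finite set `S`, and let `q` lie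
in the hyperplane `x i = a` carrying a facet of the cube, outside the zero sets of those differences
of members of `S` that do not vanish on the whole hyperplane. Then `E` is affine on a neighbourhood
of `q` in the cube: the interior of a small such neighbourhood is convex and meets none of the
hyperplanes along which `E` might pass from one member of `S` to another. -/
lemma exists_eq_intAffine_near {n : ℕ} {E : (Fin n → ℝ) → ℝ} (hE : Continuous E)
    {S : Set ((Fin n → ℤ) × ℤ)} (hS : S.Finite) (hES : ∀ x, ∃ c ∈ S, E x = intAffine c x)
    {i : Fin n} {a : ℝ} (ha : a = 0 ∨ a = 1) {q : Fin n → ℝ} (hq : q ∈ unitCube n)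
    (hgen : ∀ c ∈ S, ∀ d ∈ S, (∃ y, intAffine (c - d) (Function.update y i a) ≠ 0) →
      intAffine (c - d) q ≠ 0) :
    ∃ c, ∃ ε > 0, ∀ x ∈ unitCube n, dist x q < ε → E x = intAffine c x := by
  obtain ⟨ε, hε, hball⟩ : ∃ ε > 0, ∀ x, dist x q < ε → ∀ c ∈ S, ∀ d ∈ S,
      (∃ y, intAffine (c - d) (Function.update y i a) ≠ 0) → intAffine (c - d) x ≠ 0 := by
    refine Metric.eventually_nhds_iff.1 ?_
    rw [Filter.eventually_all_finite hS]
    intro c hc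
    rw [Filter.eventually_all_finite hS]
    intro d hd
    by_cases h : ∃ y, intAffine (c - d) (Function.update y i a) ≠ 0
    · filter_upwards [(continuous_intAffine (c - d)).continuousAt.eventually_ne
        (hgen c hc d hd h)] with x hx _ using hx
    · exact .of_forall fun x hx ↦ absurd hx h
  set W := Metric.ball q ε ∩ interior (unitCube n) with hW
  have hWconv : Convex ℝ W := (convex_ball q ε).inter (convex_unitCube n).interior
  -- Two members of `S` that agree somewhere in `W` agree everywhere.
  have hagree : ∀ x ∈ W, ∀ c ∈ S, ∀ d ∈ S, intAffine c x = intAffine d x →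
      ∀ y, intAffine c y = intAffine d y := by
    intro x hx c hc d hd hcd
    have hz : ∀ y, intAffine (c - d) (Function.update y i a) = 0 := by
      by_contra! h
      exact hball x hx.1 c hc d hd h (by rw [intAffine_sub, hcd, sub_self])
    have hxi : a - x i ≠ 0 := by
      have := interior_unitCube n ▸ hx.2
      rcases ha with rfl | rfl
      · linarith [(this i).1]
      · linarith [(this i).2]
    have hci : (((c - d).1 i : ℤ) : ℝ) = 0 := by
      have := hz x
      rw [intAffine_update, intAffine_sub, hcd, sub_self, zero_add] at this
      exact (mul_eq_zero.1 this).resolve_right hxi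
    intro y
    have := hz y
    rw [intAffine_update, hci, zero_mul, add_zero, intAffine_sub] at this
    linarith
  have hclos : Metric.ball q ε ∩ unitCube n ⊆ closure W := fun x hx ↦
    Metric.isOpen_ball.inter_closure ⟨hx.1, unitCube_subset_closure_interior n hx.2⟩
  obtain ⟨x₀, hx₀⟩ : W.Nonempty := closure_nonempty_iff.1 ⟨q, hclos ⟨Metric.mem_ball_self hε, hq⟩⟩
  obtain ⟨c, hc, hcx₀⟩ := hES x₀
  have hclosed : ∀ d, IsClosed {x | E x = intAffine d x} := fun d ↦
    isClosed_eq hE (continuous_intAffine d)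
  have hWc : W ⊆ {x | E x = intAffine c x} := by
    by_contra hcon
    obtain ⟨x₁, hx₁, hne⟩ := Set.not_subset.1 hcon
    set T := {d ∈ S | ∃ y, intAffine c y ≠ intAffine d y} with hT
    have hT' : IsClosed (⋃ d ∈ T, {x | E x = intAffine d x}) :=
      (hS.subset (Set.sep_subset _ _)).isClosed_biUnion fun d _ ↦ hclosed d
    have hcov : ∀ x, E x ≠ intAffine c x → x ∈ ⋃ d ∈ T, {x | E x = intAffine d x} := by
      intro x hx
      obtain ⟨d, hd, hdx⟩ := hES x
      exact Set.mem_biUnion (x := d) ⟨hd, x, fun h ↦ hx (hdx.trans h.symm)⟩ hdx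
    obtain ⟨z, hzW, hz1, hz2⟩ := isPreconnected_closed_iff.1 hWconv.isPreconnected _ _
      (hclosed c) hT' (fun x _ ↦ or_iff_not_imp_left.2 (hcov x)) ⟨x₀, hx₀, hcx₀⟩
      ⟨x₁, hx₁, hcov x₁ hne⟩
    obtain ⟨d, ⟨hd, y, hy⟩, hdz⟩ := Set.mem_iUnion₂.1 hz2
    exact hy (hagree z hzW c hc d hd (Eq.trans (Eq.symm hz1) hdz) y)
  exact ⟨c, ε, hε, fun x hx hxq ↦ (closure_minimal hWc (hclosed c)) (hclos ⟨hxq, hx⟩)⟩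

/-- If a piecewise integer affine continuous function is not constant on the facet `x i = a` of the
cube, then near some relatively interior point of the facet it is affine and not constant along
the facet. Otherwise its restriction to the facet would be integer-valued on a dense set, hence
everywhere, hence constant. -/
lemma exists_affine_point_of_facet {n : ℕ} {E : (Fin n → ℝ) → ℝ} (hE : Continuous E)
    (hEp : IsIntPiecewise E) {i : Fin n} {a : ℝ} (ha : a = 0 ∨ a = 1)
    {x y : Fin n → ℝ} (hx : x ∈ unitCube n) (hy : y ∈ unitCube n) (hxi : x i = a) (hyi : y i = a)
    (hxy : E x ≠ E y) :
    ∃ q : Fin n → ℝ, q i = a ∧ (∀ j, j ≠ i → 0 < q j ∧ q j < 1) ∧ q ∈ unitCube n ∧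
      ∃ c : (Fin n → ℤ) × ℤ, (∃ l, l ≠ i ∧ c.1 l ≠ 0) ∧
        ∃ ε > 0, ∀ x ∈ unitCube n, dist x q < ε → E x = intAffine c x := by
  obtain ⟨S, hS, hES⟩ := hEp
  by_contra! hcon
  set D : Set (Fin n → ℝ) := ⋂ p ∈ {p ∈ S ×ˢ S | ∃ y, intAffine (p.1 - p.2)
    (Function.update y i a) ≠ 0}, {y | intAffine (p.1 - p.2) (Function.update y i a) ≠ 0} with hD
  have hupd : Continuous fun y : Fin n → ℝ ↦ Function.update y i a :=
    continuous_id.update i continuous_const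
  have hDd : Dense D := by
    refine dense_biInter_of_isOpen (fun p _ ↦ ?_)
      ((hS.prod hS).subset (Set.sep_subset _ _)).countable
      fun p hp ↦ dense_intAffine_update_ne_zero _ i a hp.2
    exact isOpen_ne_fun ((continuous_intAffine _).comp hupd) continuous_const
  have hint : ∀ y ∈ unitCube n, ∃ k : ℤ, E (Function.update y i a) = k := by
    have hcl : IsClosed {y | E (Function.update y i a) ∈ Set.range ((↑) : ℤ → ℝ)} :=
      Int.isClosedEmbedding_coe_real.isClosed_range.preimage (hE.comp hupd)
    have hsub : interior (unitCube n) ∩ D ⊆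
        {y | E (Function.update y i a) ∈ Set.range ((↑) : ℤ → ℝ)} := by
      rintro y ⟨hyint, hyD⟩
      have hyu := update_mem_unitCube (interior_subset hyint) i ha
      obtain ⟨c, ε, hε, hc⟩ := exists_eq_intAffine_near hE hS hES ha hyu
        fun c hc d hd h ↦ Set.mem_iInter₂.1 hyD (c, d) ⟨⟨hc, hd⟩, h⟩
      rw [interior_unitCube] at hyint
      -- By assumption the coefficients of `c` other than the `i`-th vanish.
      have h0 : ∀ l, l ≠ i → c.1 l = 0 := by
        intro l hl
        by_contra hl0
        obtain ⟨z, hz, hzε, hne⟩ := hcon _ (by simp)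
          (fun j hj ↦ by simpa [hj] using hyint j) hyu c ⟨l, hl, hl0⟩ ε hε
        exact hne (hc z hz hzε)
      have hval : E (Function.update y i a) = c.2 + c.1 i * a := by
        rw [hc _ hyu (by simpa using hε), intAffine, Finset.sum_eq_single i]
        · simp
        · intro l _ hl
          simp [h0 l hl]
        · simp
      rw [Set.mem_ofPred_eq, hval]
      rcases ha with rfl | rfl
      · exact ⟨c.2, by simp⟩
      · exact ⟨c.2 + c.1 i, by simp⟩
    intro y hy
    obtain ⟨k, hk⟩ := closure_minimal hsub hcl (closure_mono (by rw [Set.inter_comm])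
      (closure_minimal (hDd.open_subset_closure_inter isOpen_interior) isClosed_closure
        (unitCube_subset_closure_interior n hy)))
    exact ⟨k, hk.symm⟩
  have := eq_of_forall_exists_int (convex_unitCube n).isPreconnected (hE.comp hupd).continuousOn
    hint hx hy
  apply hxy
  rwa [Function.comp_apply, Function.comp_apply, Function.update_eq_self_iff.2 hxi.symm,
    Function.update_eq_self_iff.2 hyi.symm] at this

/-! ### Pushing a facet inwards along level sets -/

/-- A nonconstant direction `l` of the integer affine function `c` along a facet `x i = a` of the
cube yields an integer vector `u eᵢ + w eₗ` that points into the cube and along which `c` is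
constant. -/
lemma exists_inward_level_direction {n : ℕ} (c : (Fin n → ℤ) × ℤ) {i l : Fin n} (hl : c.1 l ≠ 0)
    {a : ℝ} (ha : a = 0 ∨ a = 1) :
    ∃ u w : ℤ, c.1 i * u + c.1 l * w = 0 ∧ (a = 0 ∧ 0 < u ∨ a = 1 ∧ u < 0) := by
  rcases ha with rfl | rfl <;> rcases hl.lt_or_gt with h | h
  · exact ⟨-c.1 l, c.1 i, by ring, .inl ⟨rfl, by omega⟩⟩
  · exact ⟨c.1 l, -c.1 i, by ring, .inl ⟨rfl, h⟩⟩
  · exact ⟨c.1 l, -c.1 i, by ring, .inr ⟨rfl, h⟩⟩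
  · exact ⟨-c.1 l, c.1 i, by ring, .inr ⟨rfl, by omega⟩⟩

/-- If `E` is not constant on some facet of the cube, then there is a ℤ-map `α` of the cube into
itself with `E ∘ α = E` that is not onto: it pushes a small region of the facet into the interior
along a level set of `E`. -/
lemma exists_not_surjOn_comp_eq {n : ℕ} {E : (Fin n → ℝ) → ℝ} (hE : Continuous E)
    (hEp : IsIntPiecewise E) {i : Fin n} {a : ℝ} (ha : a = 0 ∨ a = 1)
    {x y : Fin n → ℝ} (hx : x ∈ unitCube n) (hy : y ∈ unitCube n) (hxi : x i = a) (hyi : y i = a)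
    (hxy : E x ≠ E y) :
    ∃ α : (Fin n → ℝ) → (Fin n → ℝ), Continuous α ∧ (∀ j, IsIntPiecewise fun x ↦ α x j) ∧
      (∀ x ∈ unitCube n, α x ∈ unitCube n) ∧ (∀ x ∈ unitCube n, E (α x) = E x) ∧
      ∃ q ∈ unitCube n, ∀ x ∈ unitCube n, α x ≠ q := by
  obtain ⟨q, hqi, hqj, hq, c, ⟨l, hli, hcl⟩, ε, hε, hc⟩ :=
    exists_affine_point_of_facet hE hEp ha hx hy hxi hyi hxy
  obtain ⟨u, w, huw, hu⟩ := exists_inward_level_direction c (i := i) hcl ha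
  obtain ⟨hql0, hql1⟩ := hqj l hli
  -- Both the support of the bump and the displacement have size at most `r`.
  obtain ⟨r, hr, hrε, hr0, hr1, hr2⟩ :
      ∃ r > 0, 2 * r ≤ ε ∧ 2 * r ≤ q l ∧ 2 * r ≤ 1 - q l ∧ 2 * r ≤ 1 := by
    refine ⟨min (ε / 2) (min (q l / 2) ((1 - q l) / 2)), ?_, ?_, ?_, ?_, ?_⟩
    · exact lt_min (by linarith) (lt_min (by linarith) (by linarith))
    all_goals grind
  have hδ : (0 : ℝ) < |(u : ℝ)| + |(w : ℝ)| + 1 := by positivity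
  obtain ⟨q', h, hq'j, hq'q, hhc, hhp, hh0, hhδ, hhq', hhs⟩ :=
    exists_small_bump q l hr (div_pos hr hδ)
  set v : Fin n → ℤ := Pi.single i u + Pi.single l w with hv
  have hvi : v i = u := by simp [hv, hli.symm]
  have hvl : v l = w := by simp [hv, hli]
  have hvj : ∀ j, j ≠ i → j ≠ l → v j = 0 := fun j h1 h2 ↦ by simp [hv, h1, h2]
  have hhr : ∀ x, h x * (|(u : ℝ)| + |(w : ℝ)| + 1) ≤ r := fun x ↦ (le_div_iff₀ hδ).1 (hhδ x)
  have huh : ∀ x, |u * h x| ≤ r := fun x ↦ by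
    rw [abs_mul, abs_of_nonneg (hh0 x)]
    nlinarith [hhr x, hh0 x, abs_nonneg (w : ℝ), mul_nonneg (hh0 x) (abs_nonneg (w : ℝ))]
  have hwh : ∀ x, |w * h x| ≤ r := fun x ↦ by
    rw [abs_mul, abs_of_nonneg (hh0 x)]
    nlinarith [hhr x, hh0 x, abs_nonneg (u : ℝ), mul_nonneg (hh0 x) (abs_nonneg (u : ℝ))]
  have hvh : ∀ x j, |v j * h x| ≤ r := by
    intro x j
    by_cases h1 : j = i
    · rw [h1, hvi]; exact huh x
    by_cases h2 : j = l
    · rw [h2, hvl]; exact hwh x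
    · simpa [hvj j h1 h2] using hr.le
  set α : (Fin n → ℝ) → (Fin n → ℝ) := fun x ↦ x + fun j ↦ v j * h x with hα
  have hα0 : ∀ x, h x = 0 → α x = x := fun x hx ↦ by ext j; simp [hα, hx]
  have hcube : ∀ x ∈ unitCube n, α x ∈ unitCube n := by
    intro x hx
    by_cases hhx : h x = 0
    · rwa [hα0 x hhx]
    have hd : ∀ j, |x j - q j| < r := fun j ↦ (dist_le_pi_dist x q j).trans_lt (hhs x hhx)
    intro j
    by_cases h1 : j = i
    · have h2 := abs_lt.1 (hd i)
      have h3 := abs_le.1 (huh x)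
      have h4 := hx i
      simp only [hα, Pi.add_apply, h1, hvi]
      rcases hu with ⟨ha, hu⟩ | ⟨ha, hu⟩ <;> rw [hqi, ha] at h2
      · have : (0 : ℝ) ≤ u * h x := mul_nonneg (by exact_mod_cast hu.le) (hh0 x)
        constructor <;> linarith
      · have : u * h x ≤ 0 := mul_nonpos_of_nonpos_of_nonneg (by exact_mod_cast hu.le) (hh0 x)
        constructor <;> linarith
    by_cases h2 : j = l
    · have h3 := abs_lt.1 (hd l)
      have h4 := abs_le.1 (hwh x)
      simp only [hα, Pi.add_apply, h2, hvl]
      constructor <;> linarith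
    · simpa [hα, hvj j h1 h2] using hx j
  refine ⟨α, ?_, fun j ↦ (IsIntPiecewise.coord j).add (hhp.intMul (v j)), hcube, fun x hx ↦ ?_,
    q', fun j ↦ ?_, fun x hx hxq ↦ ?_⟩
  · exact continuous_id.add (continuous_pi fun j ↦ continuous_const.mul hhc)
  · by_cases hhx : h x = 0
    · rw [hα0 x hhx]
    have hxq := hhs x hhx
    have hαx : dist (α x) x ≤ r := by
      rw [dist_pi_le_iff hr.le]
      intro j
      simpa [hα, Real.dist_eq] using hvh x j
    have hαq : dist (α x) q < ε := by linarith [dist_triangle (α x) x q]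
    rw [hc _ (hcube x hx) hαq, hc x hx (by linarith), hα, intAffine_add, add_eq_left]
    have hsum : ∑ j, c.1 j * v j = 0 := by
      simp [hv, mul_add, Finset.sum_add_distrib, Pi.single_apply, huw]
    calc ∑ j, (c.1 j : ℝ) * (v j * h x) = ((∑ j, c.1 j * v j : ℤ) : ℝ) * h x := by
          push_cast
          rw [Finset.sum_mul]
          exact Finset.sum_congr rfl fun j _ ↦ by ring
      _ = 0 := by rw [hsum]; simp
  · by_cases h2 : j = l
    · have h3 := abs_lt.1 ((dist_le_pi_dist q' q l).trans_lt hq'q)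
      rw [h2]
      constructor <;> linarith
    · rw [hq'j j h2]
      exact hq j
  · -- At the facet the displacement points strictly inward, so only a fixed point can map to `q'`.
    have hαi : x i + u * h x = a := by
      rw [← hqi, ← hq'j i hli.symm, ← hxq]
      simp [hα, hvi]
    have hx0 : h x = 0 := by
      have hxi := hx i
      rcases hu with ⟨ha, hu⟩ | ⟨ha, hu⟩
      · have hu' : (0 : ℝ) < u := by exact_mod_cast hu
        nlinarith [hh0 x]
      · have hu' : (u : ℝ) < 0 := by exact_mod_cast hu
        nlinarith [hh0 x]
    rw [hα0 x hx0] at hxq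
    rw [hxq] at hx0
    exact hhq'.ne' hx0

/-! ### Facets and the boundary -/

/-- In dimension at least two the facets of the cube hang together, so that a function constant on
each facet is constant on the boundary. -/
lemma eq_on_frontier_of_eq_on_facets {n : ℕ} (hn : 2 ≤ n) {β : Type*} {g : (Fin n → ℝ) → β}
    (hg : ∀ i a, (a = 0 ∨ a = 1) → ∀ x ∈ unitCube n, ∀ y ∈ unitCube n, x i = a → y i = a →
      g x = g y) {x y : Fin n → ℝ} (hx : x ∈ frontier (unitCube n))
    (hy : y ∈ frontier (unitCube n)) : g x = g y := by
  have : Nontrivial (Fin n) := Fin.nontrivial_iff_two_le.2 hn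
  have hadj : ∀ i j a b, i ≠ j → (a = 0 ∨ a = 1) → (b = 0 ∨ b = 1) → ∀ x ∈ unitCube n,
      ∀ y ∈ unitCube n, x i = a → y j = b → g x = g y := by
    intro i j a b hij ha hb x hx y hy hxi hyj
    have hz := update_mem_unitCube hx j hb
    rw [hg i a ha x hx _ hz hxi (by simpa [hij] using hxi),
      hg j b hb _ hz y hy (by simp) hyj]
  obtain ⟨hx, i, hi⟩ := exists_coord_of_mem_frontier hx
  obtain ⟨hy, j, hj⟩ := exists_coord_of_mem_frontier hy
  by_cases hij : i = j
  · subst hij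
    obtain ⟨k, hk⟩ := exists_ne i
    have hz := update_mem_unitCube hx k (a := 0) (.inl rfl)
    exact (hadj i k _ 0 hk.symm hi (.inl rfl) x hx _ hz rfl (by simp)).trans
      (hadj k i 0 _ hk (.inl rfl) hj _ hz y hy (by simp) rfl)
  · exact hadj i j _ _ hij hi hj x hx y hy rfl rfl

/-! ### Lifting and projecting ℤ-maps -/

lemma exists_abs_comp_cubeClamp_le {n : ℕ} {F : (Fin n → ℝ) → ℝ} (hF : Continuous F) :
    ∃ B : ℕ, ∀ x, |F (cubeClamp x)| ≤ B := by
  obtain ⟨C, hC⟩ := (isCompact_unitCube n).exists_bound_of_continuousOn hF.continuousOn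
  obtain ⟨B, hB⟩ := exists_nat_ge C
  exact ⟨B, fun x ↦ (hC _ (cubeClamp_mem x)).trans hB⟩

/-- A ℤ-map from the cube to `𝔅` lifts to a bounded ℤ-map to `ℝ`, the universal cover of `𝔅`. -/
lemma exists_zmap_lift {n : ℕ} {η : unitCube n → squareBoundary} (hη : IsZMapBetween η) :
    ∃ E : (Fin n → ℝ) → ℝ, Continuous E ∧ IsIntPiecewise E ∧ (∃ B : ℕ, ∀ x, |E x| ≤ B) ∧
      ∀ x : unitCube n, squareCover (E x) = η x := by
  obtain ⟨η', hη', hext⟩ := hη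
  rw [isZMap_iff] at hη'
  have hclamp : ∀ x, η' (cubeClamp x) ∈ squareBoundary := fun x ↦ by
    rw [hext ⟨_, cubeClamp_mem x⟩]
    exact (η _).2
  obtain ⟨E, hE, hEη⟩ := exists_lift_squareCover (hη'.1.comp continuous_cubeClamp) hclamp
  obtain ⟨B, hB⟩ := exists_abs_comp_cubeClamp_le hE
  have hcov : ∀ x, squareCover (E (cubeClamp x)) = η' (cubeClamp x) := fun x ↦ by
    rw [hEη, Function.comp_apply, cubeClamp_of_mem (cubeClamp_mem x)]
  refine ⟨fun x ↦ E (cubeClamp x), hE.comp continuous_cubeClamp,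
    .of_squareCover hB fun j ↦ ?_, ⟨B, hB⟩, fun x ↦ ?_⟩
  · simp only [hcov]
    exact (hη'.2 j).comp isIntPiecewise_cubeClamp
  · rw [hcov, cubeClamp_of_mem x.2, hext]

/-- The map to `𝔅` covered by a continuous piecewise integer affine function is a ℤ-map. -/
lemma isZMapBetween_squareCover {n : ℕ} {F : (Fin n → ℝ) → ℝ} (hF : Continuous F)
    (hFp : IsIntPiecewise F) :
    IsZMapBetween (fun x : unitCube n ↦ (⟨squareCover (F x), squareCover_mem _⟩ :
      squareBoundary)) := by
  obtain ⟨B, hB⟩ := exists_abs_comp_cubeClamp_le hF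
  refine ⟨fun x ↦ squareCover (F (cubeClamp x)), (isZMap_iff _).2
    ⟨continuous_squareCover.comp (hF.comp continuous_cubeClamp),
      fun j ↦ (hFp.comp isIntPiecewise_cubeClamp).squareCover_comp hB j⟩, fun x ↦ ?_⟩
  simp only [cubeClamp_of_mem x.2]

/-! ### A strictly more general map -/

theorem lemmap (n : ℕ) (hn : 2 ≤ n) (η : unitCube n → squareBoundary) (hη : IsZMapBetween η)
    (hbd : ∃ x y : unitCube n, (x : Fin n → ℝ) ∈ frontier (unitCube n) ∧
      (y : Fin n → ℝ) ∈ frontier (unitCube n) ∧ η x ≠ η y) :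
    ∃ θ : unitCube n → squareBoundary, IsZMapBetween θ ∧ StrictlyMoreGeneral θ η := by
  obtain ⟨E, hE, hEp, ⟨B, hB⟩, hEη⟩ := exists_zmap_lift hη
  obtain ⟨i, a, ha, x, hx, y, hy, hxi, hyi, hxy⟩ : ∃ i a, (a = 0 ∨ a = 1) ∧ ∃ x ∈ unitCube n,
      ∃ y ∈ unitCube n, x i = a ∧ y i = a ∧ E x ≠ E y := by
    by_contra! hcon
    obtain ⟨x, y, hx, hy, hxy⟩ := hbd
    refine hxy (Subtype.ext ?_)
    rw [← hEη, ← hEη, eq_on_frontier_of_eq_on_facets hn hcon hx hy]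
  obtain ⟨α, hα, hαp, hαc, hEα, q, hq, hqα⟩ :=
    exists_not_surjOn_comp_eq hE hEp ha hx hy hxi hyi hxy
  -- The image of the cube under `α` is compact, so a bump at `q` can be chosen to vanish on it.
  obtain ⟨ε, hε, hdisj⟩ : ∃ ε > 0, ∀ x ∈ unitCube n, ε ≤ dist (α x) q := by
    have hcl : IsClosed (α '' unitCube n) := ((isCompact_unitCube n).image hα).isClosed
    obtain ⟨ε, hε, hsub⟩ := Metric.isOpen_iff.1 hcl.isOpen_compl q
      fun ⟨x, hx, hxq⟩ ↦ hqα x hx hxq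
    exact ⟨ε, hε, fun x hx ↦ not_lt.1 fun h ↦ hsub h ⟨x, hx, rfl⟩⟩
  obtain ⟨g, hg, hgp, -, hgq, hgs⟩ := exists_bump q hε
  have hgα : ∀ x ∈ unitCube n, g (α x) = 0 := fun x hx ↦
    by_contra fun h ↦ (hgs _ h).not_ge (hdisj x hx)
  -- The factor `4 * B + 1` makes the range of `F` longer than that of `E`, which lies in `[-B, B]`.
  set F : (Fin n → ℝ) → ℝ := fun x ↦ E x + (4 * B + 1 : ℤ) * g x with hF
  have hFc : Continuous F := hE.add (continuous_const.mul hg)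
  have hFα : ∀ x ∈ unitCube n, F (α x) = E x := fun x hx ↦ by simp [hF, hgα x hx, hEα x hx]
  refine ⟨fun x ↦ ⟨squareCover (F x), squareCover_mem _⟩,
    isZMapBetween_squareCover hFc (hEp.add (hgp.intMul _)),
    ⟨fun x ↦ ⟨α x, hαc x x.2⟩, ⟨α, (isZMap_iff α).2 ⟨hα, hαp⟩, fun _ ↦ rfl⟩, ?_⟩, ?_⟩
  · ext1 x
    exact Subtype.ext ((congrArg squareCover (hFα x x.2)).trans (hEη x))
  · rintro ⟨β, ⟨β', hβ', hext⟩, hβ⟩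
    -- `E ∘ β` and `F` lift the same map, so they differ by a constant.
    have hint : ∀ x ∈ unitCube n, ∃ k : ℤ, (E (β' x) - F x) / 4 = k := by
      intro x hx
      obtain ⟨k, hk⟩ := exists_eq_add_of_squareCover_eq (s := E (β' x)) (t := F x) (by
        rw [hext ⟨x, hx⟩, hEη]
        exact congrArg Subtype.val (congrFun hβ ⟨x, hx⟩))
      exact ⟨k, by rw [hk]; ring⟩
    have hconst : (E (β' q) - F q) / 4 = (E (β' (α q)) - F (α q)) / 4 :=
      eq_of_forall_exists_int (convex_unitCube n).isPreconnected
        (((hE.comp hβ'.1).sub hFc).div_const 4).continuousOn hint hq (hαc q hq)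
    rw [hFα q hq] at hconst
    have h1 := abs_le.1 (hB (β' q))
    have h2 := abs_le.1 (hB (β' (α q)))
    have h4 : F q = E q + (4 * B + 1 : ℤ) * g q := rfl
    push_cast at h4
    have h5 : (4 * B + 1 : ℝ) ≤ (4 * B + 1) * g q :=
      le_mul_of_one_le_right (by positivity) hgq
    -- Equality of the constants gives `E (β' q) - E (β' (α q)) = (4 * B + 1) * g q`, which
    -- exceeds the bound `2 * B` for a difference of values of `E`.
    linarith
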